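/- Theorem 9.3. Work in ZFC. A generalized topology in a set $X$ (in the sense of Delfs and Knebusch) is a collection $\mathrm{Cov}$ of families of subsets of $X$ (the admissible families) such that, with $\mathrm{Op}=\bigcup\mathrm{Cov}$ (the open sets): $\emptyset,X\in\mathrm{Op}$; $\mathrm{Op}$ is closed under binary unions and intersections; every finite subfamily of $\mathrm{Op}$ is admissible; the union of an admissible family is open; if $\mathcal U\in\mathrm{Cov}$, $V\in\mathrm{Op}$ and $V\subseteq\bigcup\mathcal U$, then $\{V\cap U:U\in\mathcal U\}\in\mathrm{Cov}$; if $\mathcal U\in\mathrm{Cov}$ and each $U\in\mathcal U$ is the union of some $\mathcal V_U\in\mathrm{Cov}$, then $\bigcup_{U\in\mathcal U}\mathcal V_U\in\mathrm{Cov}$; if $\mathcal U\subseteq\mathrm{Op}$, $\mathcal V\in\mathrm{Cov}$, $\bigcup\mathcal V=\bigcup\mathcal U$ and each $V\in\mathcal V$ lies in some $U\in\mathcal U$, then $\mathcal U\in\mathrm{Cov}$; if $\mathcal U\in\mathrm{Cov}$, $V\subseteq\bigcup\mathcal U$ and $V\cap U\in\mathrm{Op}$ for all $U\in\mathcal U$,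 then $V\in\mathrm{Op}$. For $\mathcal O\subseteq\mathcal P(X)$ let $\mathrm{EssFin}(\mathcal O)$ be the collection of all $\mathcal U\subseteq\mathcal O$ that have a finite subfamily with the same union. $\mathrm{Cov}$ is small if $\mathrm{Cov}=\mathrm{EssFin}(\mathrm{Op})$; it is weakly normal if any two disjoint sets, each of which is a singleton or the complement of an open set, are contained in disjoint open sets; the topology it induces is the one generated by $\mathrm{Op}$. Let $X$ be an infinite set of cardinality $\kappa$. Then there are exactly $2^{2^{\kappa}}$ weakly normal small generalized topologies in $X$ that induce the discrete topology of $X$. Moreover, give $X$ the discrete topology, let $\beta X$ be its Čech–Stone compactification, and for each two-point set $K\subseteq\beta X\setminus X$ put $$\mathcal C_K=\{A\subseteq X: K\cap\mathrm{cl}_{\beta X}A=\emptyset\ \text{ or }\ K\subseteq\mathrm{cl}_{\beta X}A\}.$$ Then every $\mathcal C_K$ is a Wallman base of $X$; every $\mathrm{EssFin}(\{X\setminus A:A\in\mathcal C_K\})$ is a weakly normal small generalized topology that induces the discrete topology; distinct $K$ give distinct generalized topologies; and there are exactly $2^{2^{\kappa}}$ such sets $K$. Here a Wallman base of a topological space $X$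 is a collection $\mathcal C$ of closed sets, closed under binary unions and intersections, such that: for every closed $A$ and $x\notin A$ some $C\in\mathcal C$ satisfies $A\subseteq C$ and $x\notin C$; for every $A$ that is closed or a singleton and every $x\notin A$ some $C\in\mathcal C$ satisfies $x\in C\subseteq X\setminus A$; and for all disjoint $A_1,A_2\in\mathcal C$ there are $C_1,C_2\in\mathcal C$ with $C_1\cup C_2=X$, $A_1\cap C_1=\emptyset$ and $A_2\cap C_2=\emptyset$. -/

import Mathlib

open Cardinal

universe u

namespace GTS

/-- The open sets `Op_X = ⋃ Cov_X` of a collection `Cov` of families of subsets of `X`. -/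
def opens {X : Type u} (Cov : Set (Set (Set X))) : Set (Set X) := ⋃₀ Cov

/-- The closed sets `Cl_X`: the complements of the open sets. -/
def closeds {X : Type u} (Cov : Set (Set (Set X))) : Set (Set X) := {A | Aᶜ ∈ opens Cov}

/-- `Cov` is a generalized topology in `X` in the sense of Delfs and Knebusch: the triple
`(X, ⋃ Cov, Cov)` is a generalized topological space. The members of `Cov` are the admissible
families. -/
structure IsGeneralizedTopology {X : Type u} (Cov : Set (Set (Set X))) : Prop where
  empty_open : ∅ ∈ opens Cov
  univ_open : Set.univ ∈ opens Cov
  inter_open : ∀ U ∈ opens Cov, ∀ V ∈ opens Cov, U ∩ V ∈ opens Cov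
  union_open : ∀ U ∈ opens Cov, ∀ V ∈ opens Cov, U ∪ V ∈ opens Cov
  /-- Every finite family of open sets is admissible. -/
  finiteness : ∀ 𝒰 : Set (Set X), 𝒰 ⊆ opens Cov → 𝒰.Finite → 𝒰 ∈ Cov
  /-- The union of an admissible family is open. -/
  sUnion_open : ∀ 𝒰 ∈ Cov, ⋃₀ 𝒰 ∈ opens Cov
  /-- The trace of an admissible family on an open subset of its union is admissible. -/
  stability : ∀ 𝒰 ∈ Cov, ∀ V ∈ opens Cov, V ⊆ ⋃₀ 𝒰 → (fun U => V ∩ U) '' 𝒰 ∈ Cov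
  /-- Admissible coverings of the members of an admissible family together form an admissible
  family. -/
  transitivity : ∀ 𝒰 ∈ Cov, ∀ 𝒱 : Set X → Set (Set X),
    (∀ U ∈ 𝒰, 𝒱 U ∈ Cov ∧ ⋃₀ (𝒱 U) = U) → (⋃ U ∈ 𝒰, 𝒱 U) ∈ Cov
  /-- A family of open sets that has an admissible refinement with the same union is
  admissible. -/
  saturation : ∀ 𝒰 : Set (Set X), 𝒰 ⊆ opens Cov → ∀ 𝒱 ∈ Cov, ⋃₀ 𝒱 = ⋃₀ 𝒰 →
    (∀ V ∈ 𝒱, ∃ U ∈ 𝒰, V ⊆ U) → 𝒰 ∈ Cov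
  /-- A subset of the union of an admissible family is open if its traces on the members are. -/
  regularity : ∀ 𝒰 ∈ Cov, ∀ V : Set X, V ⊆ ⋃₀ 𝒰 → (∀ U ∈ 𝒰, V ∩ U ∈ opens Cov) →
    V ∈ opens Cov

/-- `EssFin(O)`: the essentially finite families of members of `O`, i.e. those with a finite
subfamily that has the same union. -/
def essFin {X : Type u} (O : Set (Set X)) : Set (Set (Set X)) :=
  {𝒰 | 𝒰 ⊆ O ∧ ∃ 𝒱 : Set (Set X), 𝒱 ⊆ 𝒰 ∧ 𝒱.Finite ∧ ⋃₀ 𝒰 = ⋃₀ 𝒱}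

/-- Small generalized topologies. -/
def IsSmall {X : Type u} (Cov : Set (Set (Set X))) : Prop := Cov = essFin (opens Cov)

/-- Weak normality: any two disjoint sets, each of which is a singleton or closed, are
contained in disjoint open sets. -/
def IsWeaklyNormal {X : Type u} (Cov : Set (Set (Set X))) : Prop :=
  ∀ A₁ A₂ : Set X, ((∃ x, A₁ = {x}) ∨ A₁ ∈ closeds Cov) →
    ((∃ x, A₂ = {x}) ∨ A₂ ∈ closeds Cov) → Disjoint A₁ A₂ →
    ∃ W₁ ∈ opens Cov, ∃ W₂ ∈ opens Cov, Disjoint W₁ W₂ ∧ A₁ ⊆ W₁ ∧ A₂ ⊆ W₂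

/-- The topology `τ(Op_X)` generated by the open sets, i.e. induced by `Cov`. -/
@[reducible] def inducedTopology {X : Type u} (Cov : Set (Set (Set X))) : TopologicalSpace X :=
  TopologicalSpace.generateFrom (opens Cov)

/-- The weakly normal small generalized topologies in `X` that induce the given topology
of `X`. -/
def weaklyNormalSmall (X : Type u) [τ : TopologicalSpace X] : Set (Set (Set (Set X))) :=
  {Cov | IsGeneralizedTopology Cov ∧ IsWeaklyNormal Cov ∧ IsSmall Cov ∧ inducedTopology Cov = τ}

/-- Closed bases of a topological space. -/
def IsClosedBase {X : Type u} [TopologicalSpace X] (C : Set (Set X)) : Prop :=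
  (∀ A ∈ C, IsClosed A) ∧
    ∀ A : Set X, IsClosed A → ∀ x ∉ A, ∃ D ∈ C, x ∉ D ∧ A ⊆ D

/-- Wallman bases of a topological space. -/
structure IsWallmanBase {X : Type u} [TopologicalSpace X] (C : Set (Set X)) : Prop where
  closedBase : IsClosedBase C
  union_mem : ∀ A ∈ C, ∀ B ∈ C, A ∪ B ∈ C
  inter_mem : ∀ A ∈ C, ∀ B ∈ C, A ∩ B ∈ C
  disjunctive : ∀ A : Set X, ((∃ y, A = {y}) ∨ IsClosed A) → ∀ x ∉ A,
    ∃ D ∈ C, x ∈ D ∧ D ⊆ Aᶜ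
  normal : ∀ A₁ ∈ C, ∀ A₂ ∈ C, Disjoint A₁ A₂ →
    ∃ C₁ ∈ C, ∃ C₂ ∈ C, C₁ ∪ C₂ = Set.univ ∧ Disjoint A₁ C₁ ∧ Disjoint A₂ C₂

/-- `EssFin({X ∖ A : A ∈ C})`, the collection of admissible families induced by `C`. -/
def covOf {X : Type u} (C : Set (Set X)) : Set (Set (Set X)) :=
  essFin {U | ∃ A ∈ C, U = Aᶜ}

/-- The two-point subsets `K` of the Čech–Stone remainder `βX ∖ X`. -/
def remainderPairs (X : Type u) [TopologicalSpace X] : Set (Set (StoneCech X)) :=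
  {K | K ⊆ (Set.range (stoneCechUnit : X → StoneCech X))ᶜ ∧ K.ncard = 2}

/-- `C_K`: the subsets `A` of `X` whose closure in `βX` either misses `K` or contains `K`. -/
def pairBase {X : Type u} [TopologicalSpace X] (K : Set (StoneCech X)) : Set (Set X) :=
  {A | Disjoint K (closure ((stoneCechUnit : X → StoneCech X) '' A)) ∨
    K ⊆ closure ((stoneCechUnit : X → StoneCech X) '' A)}

end GTS

/-!
For a discrete space `X` the points of `βX` are the ultrafilters on `X`, and `p ∈ cl A` means that
`A` belongs to the ultrafilter of `p` (`mem_closure_image_stoneCechUnit`). Hence for `K = {p, q}`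
the family `C_K` consists of the sets on which two distinct free ultrafilters agree
(`pairBase_pair`): it is a field of sets that contains all singletons. For a field of sets, each
member is open and closed at once, so normality is trivial; the essentially finite
families of members of any lattice of sets form a generalized topology
(`isGeneralizedTopology_essFin`).

The families `C_K` determine `K`: if `p` does not lie in `K'`, then some `A` belongs to the
ultrafilter of `p`, but to none of the ultrafilters of the other points of `K ∪ K'`; thus
`A ∈ C_K' \ C_K` (`mem_of_setOf_mem_iff_mem_eq`).

A small generalized topology is determined by its open sets, so there are at most `2 ^ 2 ^ κ` of
them. As distinct `K` give distinct generalized topologies, it remains to find `2 ^ 2 ^ κ`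
pairs `K`, that is, Pospíšil's theorem that there are `2 ^ 2 ^ κ` ultrafilters on `X`
(`mk_ultrafilter`). It is proved with an independent family of `2 ^ κ` subsets of a set of
cardinality `κ` (`traceSet`): each choice of members and complements of members
of this family has the finite intersection property, hence extends to an ultrafilter, and different
choices extend to different ultrafilters.
-/

open Set

namespace GTS

/-! ### The number of ultrafilters on an infinite set -/

/-- The members of the Fichtenholz–Kantorovich–Hausdorff independent family: the set of all pairs
`(F, 𝒮)`, with `F` a finite subset of `X` and `𝒮` a finite set of finite subsets of `X`, such that
the trace of `A` on `F` belongs to `𝒮`. -/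
def traceSet {X : Type u} (A : Set X) : Set (Finset X × Finset (Finset X)) :=
  {i | ∃ G ∈ i.2, (G : Set X) = ↑i.1 ∩ A}

/-- Any finitely many subsets of `X` are distinguished by their traces on some finite set. -/
theorem exists_finset_inter_injOn {X : Type u} [Nonempty X] {T : Set (Set X)} (hT : T.Finite) :
    ∃ F : Finset X, InjOn (fun A => (F : Set X) ∩ A) T := by
  have key : ∀ A B : Set X, A ≠ B → ∃ x, ¬ (x ∈ A ↔ x ∈ B) := fun A B h => by
    by_contra! h'
    exact h (Set.ext h')
  choose! w hw using key
  have hfin : (image2 w T T).Finite := hT.image2 w hT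
  refine ⟨hfin.toFinset, fun A hA B hB hAB => ?_⟩
  by_contra hne
  have hmem : w A B ∈ image2 w T T := mem_image2_of_mem hA hB
  have := Set.ext_iff.1 hAB (w A B)
  simp only [Finite.coe_toFinset, mem_inter_iff, hmem, true_and] at this
  exact hw A B hne this

/-- The family of all `traceSet A` is independent: an arbitrary choice of members and complements
of members is contained in an ultrafilter. -/
theorem exists_ultrafilter_traceSet_mem_iff {X : Type u} [Nonempty X] (S : Set (Set X)) :
    ∃ u : Ultrafilter (Finset X × Finset (Finset X)), ∀ A, traceSet A ∈ u ↔ A ∈ S := by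
  classical
  let g : Set X → Set (Finset X × Finset (Finset X)) :=
    fun A => if A ∈ S then traceSet A else (traceSet A)ᶜ
  have hne : (Filter.generate (range g)).NeBot := by
    rw [Filter.generate_neBot_iff]
    intro t ht htf
    obtain ⟨T, -, hT, rfl⟩ : ∃ T ⊆ Set.univ, T.Finite ∧ t = g '' T :=
      exists_subset_image_finite_and.1 ⟨t, by rwa [image_univ], htf, rfl⟩
    obtain ⟨F, hF⟩ := exists_finset_inter_injOn hT
    -- On the sets of `T`, the pair `(F, {F ∩ A | A ∈ T ∩ S})` realizes the prescribed pattern.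
    refine ⟨(F, (hT.inter_of_left S).toFinset.image fun A => F.filter (· ∈ A)), ?_⟩
    rintro _ ⟨A, hA, rfl⟩
    by_cases hAS : A ∈ S
    · simp only [g, if_pos hAS]
      refine ⟨F.filter (· ∈ A), Finset.mem_image_of_mem _ (by simp [hA, hAS]), ?_⟩
      ext x
      simp
    · simp only [g, if_neg hAS]
      rintro ⟨G, hG, hGA⟩
      obtain ⟨B, hB, rfl⟩ := Finset.mem_image.1 hG
      have hB' : B ∈ T ∧ B ∈ S := by simpa using hB
      have : B = A := hF hB'.1 hA <| by
        simp only
        rw [← hGA]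
        ext x
        simp
      exact hAS (this ▸ hB'.2)
  obtain ⟨u, hu⟩ := Filter.exists_ultrafilter_le (Filter.generate (range g))
  have hg : ∀ A, g A ∈ u := fun A => hu (Filter.mem_generate_of_mem (mem_range_self A))
  refine ⟨u, fun A => ⟨fun h => ?_, fun h => by simpa [g, h] using hg A⟩⟩
  by_contra hA
  have := hg A
  simp only [g, if_neg hA] at this
  exact Ultrafilter.compl_mem_iff_notMem.1 this h

/-- Pospíšil's theorem: an ultrafilter on `Finset X × Finset (Finset X)`, a set equipotent to `X`,
is found for each of the `2 ^ 2 ^ #X` sets of subsets of `X`. -/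
theorem mk_ultrafilter (X : Type u) [Infinite X] :
    #(Ultrafilter X) = 2 ^ (2 ^ #X : Cardinal.{u}) := by
  rw [← mk_set, ← mk_set]
  refine le_antisymm ?_ ?_
  · refine mk_le_of_injective (f := fun u : Ultrafilter X => {A | A ∈ u}) fun u v h => ?_
    exact Ultrafilter.ext fun A => Set.ext_iff.1 h A
  · have hI : #(Finset X × Finset (Finset X)) = #X := by simp
    obtain ⟨e⟩ := Cardinal.eq.1 hI
    choose U hU using exists_ultrafilter_traceSet_mem_iff (X := X)
    refine mk_le_of_injective (f := fun S => (U S).map e) fun S S' h => ?_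
    ext A
    rw [← hU S, ← hU S']
    have := congrArg (fun u : Ultrafilter X => e '' traceSet A ∈ u) h
    simpa [Ultrafilter.mem_map, preimage_image_eq _ e.injective] using this

/-! ### Pairs of ultrafilters and the fields of sets on which they agree -/

/-- An ultrafilter outside a finite set of ultrafilters contains a set that
belongs to none of them. -/
theorem exists_mem_forall_notMem {X : Type u} {u : Ultrafilter X} {T : Set (Ultrafilter X)}
    (hT : T.Finite) (hu : u ∉ T) : ∃ A ∈ u, ∀ v ∈ T, A ∉ v := by
  have key : ∀ v : Ultrafilter X, v ∈ T → ∃ A ∈ u, A ∉ v := fun v hv => by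
    by_contra! h
    exact hu (Ultrafilter.coe_le_coe.1 h ▸ hv)
  choose! B hBu hBv using key
  refine ⟨⋂ v ∈ T, B v, (Filter.biInter_mem hT).2 hBu, fun v hv h => ?_⟩
  exact hBv v hv (Filter.mem_of_superset h (biInter_subset_of_mem hv))

/-- If `u` were neither `u'` nor `v'`, some `A ∈ u` would belong to none of `v`, `u'` and `v'`, so
that `u'` and `v'`, but not `u` and `v`, would agree on `A`. -/
theorem mem_of_setOf_mem_iff_mem_eq {X : Type u} {u v u' v' : Ultrafilter X} (huv : u ≠ v)
    (h : {A | A ∈ u ↔ A ∈ v} = {A | A ∈ u' ↔ A ∈ v'}) : u ∈ ({u', v'} : Set (Ultrafilter X)) := by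
  by_contra hu
  obtain ⟨A, hAu, hA⟩ := exists_mem_forall_notMem (T := {v, u', v'}) (by simp) (u := u)
    (by simpa [huv] using hu)
  simp only [mem_insert_iff, mem_singleton_iff, forall_eq_or_imp, forall_eq] at hA
  have := Set.ext_iff.1 h A
  simp [hAu, hA] at this

theorem pair_eq_of_setOf_mem_iff_mem_eq {X : Type u} {u v u' v' : Ultrafilter X} (huv : u ≠ v)
    (huv' : u' ≠ v') (h : {A | A ∈ u ↔ A ∈ v} = {A | A ∈ u' ↔ A ∈ v'}) :
    ({u, v} : Set (Ultrafilter X)) = {u', v'} := by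
  have symm : ∀ a b : Ultrafilter X, {A | A ∈ a ↔ A ∈ b} = {A | A ∈ b ↔ A ∈ a} :=
    fun a b => Set.ext fun A => Iff.comm
  apply Subset.antisymm
  · exact pair_subset (mem_of_setOf_mem_iff_mem_eq huv h)
      (mem_of_setOf_mem_iff_mem_eq huv.symm (symm v u ▸ h))
  · exact pair_subset (mem_of_setOf_mem_iff_mem_eq huv' h.symm)
      (mem_of_setOf_mem_iff_mem_eq huv'.symm (symm v' u' ▸ h.symm))

/-! ### The Čech–Stone compactification of a discrete space -/

theorem mem_closure_image_pure {X : Type u} {A : Set X} {u : Ultrafilter X} :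
    u ∈ closure ((pure : X → Ultrafilter X) '' A) ↔ A ∈ u := by
  constructor
  · intro h
    refine closure_minimal (t := {u : Ultrafilter X | A ∈ u}) ?_ (ultrafilter_isClosed_basic A) h
    rintro _ ⟨x, hx, rfl⟩
    exact hx
  · intro h
    rw [ultrafilterBasis_is_basis.mem_closure_iff]
    rintro _ ⟨B, rfl⟩ hB
    obtain ⟨x, hxA, hxB⟩ := u.nonempty_of_mem (Filter.inter_mem h hB)
    exact ⟨pure x, hxB, x, hxA, rfl⟩

section StoneCech

variable (X : Type u) [TopologicalSpace X] [DiscreteTopology X]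

/-- The canonical homeomorphism from the space of ultrafilters on a discrete space `X` onto
its Čech–Stone compactification: an ultrafilter goes to its limit, and the inverse map is the
continuous extension of `x ↦ pure x`. -/
noncomputable def ultrafilterHomeomorphStoneCech : Ultrafilter X ≃ₜ StoneCech X where
  toFun := Ultrafilter.extend stoneCechUnit
  invFun := stoneCechExtend (continuous_of_discreteTopology (f := (pure : X → Ultrafilter X)))
  left_inv := by
    refine congrFun (denseRange_pure.equalizer ((continuous_stoneCechExtend _).comp
      (continuous_ultrafilter_extend _)) continuous_id (funext fun x => ?_))
    simp [ultrafilter_extend_pure, stoneCechExtend_stoneCechUnit]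
  right_inv := by
    refine congrFun (denseRange_stoneCechUnit.equalizer ((continuous_ultrafilter_extend _).comp
      (continuous_stoneCechExtend _)) continuous_id (funext fun x => ?_))
    simp [ultrafilter_extend_pure, stoneCechExtend_stoneCechUnit]
  continuous_toFun := continuous_ultrafilter_extend _
  continuous_invFun := continuous_stoneCechExtend _

variable {X}

@[simp]
theorem ultrafilterHomeomorphStoneCech_pure (x : X) :
    ultrafilterHomeomorphStoneCech X (pure x) = stoneCechUnit x :=
  ultrafilter_extend_pure _ _

theorem mem_closure_image_stoneCechUnit {A : Set X} {u : Ultrafilter X} :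
    ultrafilterHomeomorphStoneCech X u ∈ closure ((stoneCechUnit : X → StoneCech X) '' A) ↔
      A ∈ u := by
  have : (stoneCechUnit : X → StoneCech X) '' A =
      ultrafilterHomeomorphStoneCech X '' ((pure : X → Ultrafilter X) '' A) := by
    simp [image_image]
  rw [this, ← Homeomorph.image_closure,
    (ultrafilterHomeomorphStoneCech X).injective.mem_set_image, mem_closure_image_pure]

theorem mem_remainderPairs_iff {K : Set (StoneCech X)} :
    K ∈ remainderPairs X ↔ ∃ u v : Ultrafilter X, u ≠ v ∧ u ∉ range pure ∧ v ∉ range pure ∧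
      K = ultrafilterHomeomorphStoneCech X '' {u, v} := by
  have hr : ∀ u, ultrafilterHomeomorphStoneCech X u ∈ range (stoneCechUnit : X → StoneCech X) ↔
      u ∈ range (pure : X → Ultrafilter X) := fun u => by
    simp only [mem_range, ← ultrafilterHomeomorphStoneCech_pure, EmbeddingLike.apply_eq_iff_eq]
  constructor
  · rintro ⟨hK, hcard⟩
    obtain ⟨p, q, hpq, rfl⟩ := ncard_eq_two.1 hcard
    obtain ⟨u, rfl⟩ := (ultrafilterHomeomorphStoneCech X).surjective p
    obtain ⟨v, rfl⟩ := (ultrafilterHomeomorphStoneCech X).surjective q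
    refine ⟨u, v, fun h => hpq (h ▸ rfl), ?_, ?_, (image_pair _ _ _).symm⟩
    · exact fun h => hK (mem_insert _ _) ((hr u).2 h)
    · exact fun h => hK (mem_insert_of_mem _ rfl) ((hr v).2 h)
  · rintro ⟨u, v, huv, hu, hv, rfl⟩
    rw [image_pair]
    refine ⟨pair_subset (mt (hr u).1 hu) (mt (hr v).1 hv), ncard_pair fun h => huv ?_⟩
    exact (ultrafilterHomeomorphStoneCech X).injective h

/-- `C_K` consists of the sets on which the two ultrafilters of `K` agree. -/
theorem pairBase_pair (u v : Ultrafilter X) :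
    pairBase (ultrafilterHomeomorphStoneCech X '' {u, v}) = {A | A ∈ u ↔ A ∈ v} := by
  ext A
  simp only [pairBase, image_pair, disjoint_insert_left, disjoint_singleton_left, insert_subset_iff,
    singleton_subset_iff, mem_closure_image_stoneCechUnit, mem_ofPred_eq]
  tauto

theorem mk_remainderPairs_ge [Infinite X] :
    2 ^ (2 ^ #X : Cardinal.{u}) ≤ #(remainderPairs X) := by
  have hfree : #((range (pure : X → Ultrafilter X))ᶜ : Set (Ultrafilter X)) =
      2 ^ (2 ^ #X : Cardinal.{u}) := by
    have : Infinite (Ultrafilter X) := Infinite.of_injective _ (Ultrafilter.pure_injective (α := X))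
    rw [mk_compl_of_infinite, mk_ultrafilter]
    rw [mk_ultrafilter]
    exact mk_range_le.trans_lt ((cantor _).trans (cantor _))
  rw [← hfree]
  have hinf : Infinite ((range (pure : X → Ultrafilter X))ᶜ : Set (Ultrafilter X)) := by
    rw [infinite_iff, hfree]
    exact (aleph0_le_mk X).trans ((cantor _).trans (cantor _)).le
  obtain ⟨u⟩ : Nonempty ((range (pure : X → Ultrafilter X))ᶜ : Set (Ultrafilter X)) := inferInstance
  have hu : #(({u}ᶜ : Set ((range (pure : X → Ultrafilter X))ᶜ : Set (Ultrafilter X)))) =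
      #((range (pure : X → Ultrafilter X))ᶜ : Set (Ultrafilter X)) :=
    mk_compl_of_infinite _ (by simpa using one_lt_aleph0.trans_le (infinite_iff.1 hinf))
  rw [← hu]
  -- One point `u` of the remainder is fixed, and the other one varies.
  refine mk_le_of_injective (f := fun v => ⟨ultrafilterHomeomorphStoneCech X '' {u.1, v.1.1},
    mem_remainderPairs_iff.2 ⟨u.1, v.1.1, fun h => v.2 (Subtype.ext h.symm), u.2, v.1.2, rfl⟩⟩)
    fun v w h => ?_
  have h1 := (ultrafilterHomeomorphStoneCech X).injective.image_injective (Subtype.mk.inj h)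
  have h2 : v.1.1 ∈ ({u.1, w.1.1} : Set (Ultrafilter X)) := h1 ▸ mem_insert_of_mem _ rfl
  rcases h2 with h2 | h2
  · exact absurd (Subtype.ext h2) v.2
  · exact Subtype.ext (Subtype.ext h2)

end StoneCech

/-! ### Essentially finite families of a lattice of sets -/

section EssFin

variable {X : Type u} {O : Set (Set X)}

theorem mem_essFin_of_finite {𝒰 : Set (Set X)} (h : 𝒰 ⊆ O) (hf : 𝒰.Finite) : 𝒰 ∈ essFin O :=
  ⟨h, 𝒰, Subset.rfl, hf, rfl⟩

theorem opens_essFin (O : Set (Set X)) : opens (essFin O) = O := by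
  refine Subset.antisymm (sUnion_subset fun 𝒰 h => h.1) fun U hU => ?_
  exact ⟨{U}, mem_essFin_of_finite (singleton_subset_iff.2 hU) (finite_singleton U), rfl⟩

theorem sUnion_mem_of_finite (h0 : ∅ ∈ O) (hU : ∀ U ∈ O, ∀ V ∈ O, U ∪ V ∈ O) {𝒰 : Set (Set X)}
    (h𝒰 : 𝒰.Finite) (h : 𝒰 ⊆ O) : ⋃₀ 𝒰 ∈ O := by
  induction 𝒰, h𝒰 using Set.Finite.induction_on with
  | empty => simpa using h0
  | insert _ _ ih =>
    rw [sUnion_insert]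
    exact hU _ (h (mem_insert _ _)) _ (ih ((subset_insert _ _).trans h))

theorem isGeneralizedTopology_essFin (h0 : ∅ ∈ O) (h1 : Set.univ ∈ O)
    (hI : ∀ U ∈ O, ∀ V ∈ O, U ∩ V ∈ O) (hU : ∀ U ∈ O, ∀ V ∈ O, U ∪ V ∈ O) :
    IsGeneralizedTopology (essFin O) := by
  constructor <;> try simp only [opens_essFin]
  · exact h0
  · exact h1
  · exact hI
  · exact hU
  · exact fun 𝒰 => mem_essFin_of_finite
  · rintro 𝒰 ⟨h𝒰, 𝒱, h𝒱𝒰, hfin, heq⟩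
    exact heq ▸ sUnion_mem_of_finite h0 hU hfin (h𝒱𝒰.trans h𝒰)
  · rintro 𝒰 ⟨h𝒰, 𝒱, h𝒱𝒰, hfin, heq⟩ V hV -
    refine ⟨?_, (fun U => V ∩ U) '' 𝒱, image_mono h𝒱𝒰, hfin.image _, ?_⟩
    · rintro _ ⟨U, hU, rfl⟩
      exact hI V hV U (h𝒰 hU)
    · simp only [sUnion_image, ← inter_iUnion₂, ← sUnion_eq_biUnion, heq]
  · rintro 𝒰 ⟨h𝒰, 𝒱, h𝒱𝒰, hfin, heq⟩ 𝒲 h𝒲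
    choose! ℱ h1 h2 h3 using fun U hU => (h𝒲 U hU).1.2
    have hsub : (⋃ U ∈ 𝒱, ℱ U) ⊆ ⋃ U ∈ 𝒰, 𝒲 U :=
      biUnion_mono h𝒱𝒰 h1
    refine ⟨iUnion₂_subset fun U hU => (h𝒲 U hU).1.1, _, hsub,
      hfin.biUnion fun U hU => h2 U (h𝒱𝒰 hU), ?_⟩
    refine Subset.antisymm ?_ (sUnion_subset_sUnion hsub)
    rintro x ⟨W, hW, hx⟩
    obtain ⟨U, hU, hWU⟩ := mem_iUnion₂.1 hW
    have hxU : x ∈ ⋃₀ 𝒰 := ⟨U, hU, (h𝒲 U hU).2 ▸ ⟨W, hWU, hx⟩⟩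
    obtain ⟨V, hV, hxV⟩ := heq ▸ hxU
    rw [← (h𝒲 V (h𝒱𝒰 hV)).2, h3 V (h𝒱𝒰 hV)] at hxV
    obtain ⟨F, hF, hxF⟩ := hxV
    exact ⟨F, mem_iUnion₂.2 ⟨V, hV, hF⟩, hxF⟩
  · rintro 𝒰 h𝒰 𝒱 ⟨-, ℱ, hℱ𝒱, hfin, hℱ⟩ heq href
    choose! r hr hsub using href
    have himg : r '' ℱ ⊆ 𝒰 := image_subset_iff.2 fun F hF => hr F (hℱ𝒱 hF)
    refine ⟨h𝒰, r '' ℱ, himg, hfin.image r, Subset.antisymm ?_ (sUnion_subset_sUnion himg)⟩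
    rw [← heq, hℱ]
    rintro x ⟨F, hF, hx⟩
    exact ⟨r F, mem_image_of_mem r hF, hsub F (hℱ𝒱 hF) hx⟩
  · rintro 𝒰 ⟨h𝒰, 𝒱, h𝒱𝒰, hfin, heq⟩ V hV hVU
    have : V = ⋃₀ ((fun U => V ∩ U) '' 𝒱) := by
      simp only [sUnion_image, ← inter_iUnion₂, ← sUnion_eq_biUnion]
      exact (inter_eq_left.2 (heq ▸ hV)).symm
    rw [this]
    refine sUnion_mem_of_finite h0 hU (hfin.image _) ?_
    rintro _ ⟨U, hU, rfl⟩
    exact hVU U (h𝒱𝒰 hU)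

/-- A small generalized topology is determined by its open sets. -/
theorem mk_weaklyNormalSmall_le (X : Type u) [TopologicalSpace X] :
    #(weaklyNormalSmall X) ≤ 2 ^ (2 ^ #X : Cardinal.{u}) := by
  rw [← mk_set, ← mk_set]
  refine mk_le_of_injective (f := fun Cov => opens Cov.1) fun Cov Cov' h => Subtype.ext ?_
  exact Cov.2.2.2.1.trans ((congrArg essFin h).trans Cov'.2.2.2.1.symm)

end EssFin

/-! ### Fields of sets as Wallman bases -/

section FieldOfSets

variable {X : Type u} {C : Set (Set X)}

/-- `C` is a field of subsets of `X` that contains all singletons. -/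
structure IsPointedField (C : Set (Set X)) : Prop where
  empty_mem : ∅ ∈ C
  compl_mem : ∀ A ∈ C, Aᶜ ∈ C
  inter_mem : ∀ A ∈ C, ∀ B ∈ C, A ∩ B ∈ C
  singleton_mem : ∀ x, {x} ∈ C

theorem IsPointedField.union_mem (h : IsPointedField C) : ∀ A ∈ C, ∀ B ∈ C, A ∪ B ∈ C := by
  intro A hA B hB
  rw [union_eq_compl_compl_inter_compl]
  exact h.compl_mem _ (h.inter_mem _ (h.compl_mem _ hA) _ (h.compl_mem _ hB))

theorem IsPointedField.isWallmanBase [TopologicalSpace X] [DiscreteTopology X]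
    (h : IsPointedField C) : IsWallmanBase C where
  closedBase := ⟨fun A _ => isClosed_discrete A, fun A _ x hx =>
    ⟨{x}ᶜ, h.compl_mem _ (h.singleton_mem x), by simp, by simpa using hx⟩⟩
  union_mem := h.union_mem
  inter_mem := h.inter_mem
  disjunctive := fun A _ x hx => ⟨{x}, h.singleton_mem x, rfl, by simpa using hx⟩
  -- The complement of `A₁` and `A₁` itself separate `A₁` from `A₂`.
  normal := fun A₁ h₁ A₂ _ hd =>
    ⟨A₁ᶜ, h.compl_mem _ h₁, A₁, h₁, compl_union_self A₁, disjoint_compl_right, hd.symm⟩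

theorem opens_covOf (C : Set (Set X)) : opens (covOf C) = compl '' C := by
  rw [covOf, opens_essFin]
  ext U
  simp [eq_comm]

theorem IsPointedField.compl_image (h : IsPointedField C) : compl '' C = C := by
  refine Subset.antisymm (image_subset_iff.2 h.compl_mem) fun A hA => ?_
  exact ⟨Aᶜ, h.compl_mem A hA, compl_compl A⟩

theorem IsPointedField.opens_covOf_eq (h : IsPointedField C) : opens (covOf C) = C :=
  (opens_covOf C).trans h.compl_image

theorem IsPointedField.covOf_mem_weaklyNormalSmall [TopologicalSpace X] [DiscreteTopology X]
    (h : IsPointedField C) : covOf C ∈ weaklyNormalSmall X := by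
  have hcov : covOf C = essFin C :=
    congrArg essFin ((opens_essFin _).symm.trans h.opens_covOf_eq)
  refine ⟨?_, ?_, ?_, ?_⟩
  · rw [hcov]
    refine isGeneralizedTopology_essFin h.empty_mem ?_ h.inter_mem h.union_mem
    exact compl_empty (α := X) ▸ h.compl_mem _ h.empty_mem
  · have hmem : ∀ A : Set X, ((∃ x, A = {x}) ∨ A ∈ closeds (covOf C)) → A ∈ C := by
      rintro A (⟨x, rfl⟩ | hA)
      · exact h.singleton_mem x
      · rw [closeds, mem_ofPred_eq, h.opens_covOf_eq] at hA
        exact compl_compl A ▸ h.compl_mem _ hA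
    -- Members of `C` are open, so that they separate themselves.
    intro A₁ A₂ h₁ h₂ hd
    rw [h.opens_covOf_eq]
    exact ⟨A₁, hmem A₁ h₁, A₂, hmem A₂ h₂, hd, Subset.rfl, Subset.rfl⟩
  · rw [IsSmall, h.opens_covOf_eq, hcov]
  · rw [inducedTopology, h.opens_covOf_eq, DiscreteTopology.eq_bot (α := X)]
    refine eq_bot_of_singletons_open fun x => ?_
    exact TopologicalSpace.isOpen_generateFrom_of_mem (h.singleton_mem x)

end FieldOfSets

/-! ### The families `C_K` -/

theorem notMem_of_notMem_range_pure {X : Type u} {u : Ultrafilter X} (hu : u ∉ range pure)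
    (x : X) : {x} ∉ u := fun h => by
  obtain ⟨y, -, hy⟩ := Ultrafilter.eq_pure_of_finite_mem (finite_singleton x) h
  exact hu ⟨y, hy.symm⟩

theorem isPointedField_setOf_mem_iff_mem {X : Type u} {u v : Ultrafilter X}
    (hu : u ∉ range pure) (hv : v ∉ range pure) : IsPointedField {A | A ∈ u ↔ A ∈ v} where
  empty_mem := by simp
  compl_mem := fun A hA => by
    simpa [Ultrafilter.compl_mem_iff_notMem] using not_congr hA
  inter_mem := fun A hA B hB => by
    have h : ∀ w : Ultrafilter X, A ∩ B ∈ w ↔ A ∈ w ∧ B ∈ w := fun w => Filter.inter_mem_iff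
    simp only [mem_ofPred_eq, h] at *
    exact and_congr hA hB
  singleton_mem := fun x => iff_of_false (notMem_of_notMem_range_pure hu x)
    (notMem_of_notMem_range_pure hv x)

theorem isPointedField_pairBase {X : Type u} [TopologicalSpace X] [DiscreteTopology X]
    {K : Set (StoneCech X)} (hK : K ∈ remainderPairs X) : IsPointedField (pairBase K) := by
  obtain ⟨u, v, -, hu, hv, rfl⟩ := mem_remainderPairs_iff.1 hK
  exact pairBase_pair u v ▸ isPointedField_setOf_mem_iff_mem hu hv

theorem injOn_covOf_pairBase (X : Type u) [TopologicalSpace X] [DiscreteTopology X] :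
    InjOn (fun K => covOf (pairBase K)) (remainderPairs X) := by
  intro K hK K' hK' h
  have hbase : pairBase K = pairBase K' :=
    (isPointedField_pairBase hK).opens_covOf_eq.symm.trans
      ((congrArg opens h).trans (isPointedField_pairBase hK').opens_covOf_eq)
  obtain ⟨u, v, huv, -, -, rfl⟩ := mem_remainderPairs_iff.1 hK
  obtain ⟨u', v', huv', -, -, rfl⟩ := mem_remainderPairs_iff.1 hK'
  rw [pairBase_pair, pairBase_pair] at hbase
  rw [pair_eq_of_setOf_mem_iff_mem_eq huv huv' hbase]

end GTS

theorem theorem9p3 (X : Type u) [Infinite X] [TopologicalSpace X] [DiscreteTopology X] :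
    #(GTS.weaklyNormalSmall X) = 2 ^ (2 ^ #X : Cardinal.{u}) ∧
    (∀ K ∈ GTS.remainderPairs X,
      GTS.IsWallmanBase (GTS.pairBase K) ∧
        GTS.covOf (GTS.pairBase K) ∈ GTS.weaklyNormalSmall X) ∧
    Set.InjOn (fun K => GTS.covOf (GTS.pairBase K)) (GTS.remainderPairs X) ∧
    #(GTS.remainderPairs X) = 2 ^ (2 ^ #X : Cardinal.{u}) := by
  have hle : #(GTS.remainderPairs X) ≤ #(GTS.weaklyNormalSmall X) :=
    mk_le_of_injective (f := fun K => ⟨GTS.covOf (GTS.pairBase K.1),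
      (GTS.isPointedField_pairBase K.2).covOf_mem_weaklyNormalSmall⟩) fun K K' h =>
      Subtype.ext (GTS.injOn_covOf_pairBase X K.2 K'.2 (Subtype.mk.inj h))
  have hge := GTS.mk_remainderPairs_ge (X := X)
  have hub := GTS.mk_weaklyNormalSmall_le X
  exact ⟨le_antisymm hub (hge.trans hle),
    fun K hK => ⟨(GTS.isPointedField_pairBase hK).isWallmanBase,
      (GTS.isPointedField_pairBase hK).covOf_mem_weaklyNormalSmall⟩,
    GTS.injOn_covOf_pairBase X, le_antisymm (hle.trans hub) hge⟩
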